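/- Let $R$ be a commutative Noetherian local ring of Krull dimension $d$, let $\mathfrak a\subseteq R$ be an ideal, and let $M$ and $N$ be finitely generated $R$-modules such that $M$ has finite projective dimension. Suppose that at least one of $M$, $N$ is locally free over $\operatorname{Spec}(R)\setminus V(\mathfrak a)$, i.e. its localization at every prime ideal $\mathfrak p\not\supseteq\mathfrak a$ is a free $R_{\mathfrak p}$-module. For a finitely generated $R$-module $L$ let $\operatorname{grade}_R(\mathfrak a,L)$ denote the supremum of the lengths of $L$-regular sequences contained in $\mathfrak a$, with the convention $\operatorname{grade}_R(\mathfrak a,L)=\infty$ if $\mathfrak aL=L$. Let $r$ be an integer with $0\le r<d$ such that $$\operatorname{grade}_R(\mathfrak a,M)+\operatorname{grade}_R(\mathfrak a,N)\ \ge\ d+r+1 .$$ Then the local cohomology modules satisfy $H^i_{\mathfrak a}(M\otimes_R N)=0$ for all $0\le i\le r$. -/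

import Mathlib

open CategoryTheory Limits
open scoped TensorProduct

universe u

open Classical in
/-- The grade `grade_R(𝔞, M)` of an ideal `𝔞` on a module `M`: the supremum of the lengths of the
`M`-regular sequences consisting of elements of `𝔞`, with the usual convention that it is `∞`
when `𝔞 M = M`. -/
noncomputable def moduleGrade {R : Type*} [CommRing R] (𝔞 : Ideal R)
    (M : Type*) [AddCommGroup M] [Module R M] : ℕ∞ :=
  if 𝔞 • (⊤ : Submodule R M) = ⊤ then ⊤
  else ⨆ (rs : List R) (_ : ∀ x ∈ rs, x ∈ 𝔞) (_ : RingTheory.Sequence.IsRegular M rs),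
    (rs.length : ℕ∞)

/-- `M` is locally free over `Spec(R) ∖ V(𝔞)`: the localization `M_𝔭` is a free `R_𝔭`-module for
every prime ideal `𝔭` that does not contain `𝔞`. -/
def IsLocallyFreeOff {R : Type*} [CommRing R] (𝔞 : Ideal R)
    (M : Type*) [AddCommGroup M] [Module R M] : Prop :=
  ∀ 𝔭 : PrimeSpectrum R, 𝔭 ∉ PrimeSpectrum.zeroLocus (𝔞 : Set R) →
    𝔭 ∈ Module.freeLocus R M

/-! Set aside the degenerate cases and let p = pd M. By Auslander–Buchsbaum, grade(𝔞, M) ≤ depth M =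
depth R - p ≤ d - p, so the hypothesis yields grade(𝔞, N) ≥ p + r + 1 (`exists_ext_self_nontrivial`,
`exists_nontrivial_ext_of_projectiveDimension`).

Grade is read as vanishing of Ext^i(K, -) for finite K supported in V(𝔞), and tensoring with M costs
at most p degrees of it (`ExtVanishesBelow.tensor`). The proof is induction on p along 0 → M' → Rᵐ →
M → 0. Local freeness makes Tor₁(M, N) supported in V(𝔞); it embeds in M' ⊗ N, which has no nonzero
finite submodule with such support, so it vanishes. The sequence therefore stays exact after
tensoring with N, and the long exact Ext sequence loses one degree. Taking K = R/𝔞^t and passing to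
the colimit over t gives local cohomology. -/

/-! ### Local cohomology as a colimit of Ext modules -/

section OldExt

variable {R : Type u} [CommRing R]

/-- The vanishing of `Ext` defined through the derived category implies the vanishing of `Ext`
defined by left deriving the linear Yoneda functor. -/
lemma isZero_ext_of_subsingleton (K X : ModuleCat.{u} R) (i : ℕ)
    (h : Subsingleton (Abelian.Ext K X i)) :
    IsZero (((Ext R (ModuleCat.{u} R) i).obj (Opposite.op K)).obj X) := by
  let P := projectiveResolution K
  refine IsZero.of_iso ?_ (P.isoExt i X)
  rw [← HomologicalComplex.exactAt_iff_isZero_homology]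
  cases i with
  | zero =>
    rw [HomologicalComplex.exactAt_iff' _ 0 0 1 (by simp) (by simp),
      ShortComplex.moduleCat_exact_iff]
    intro (f : P.complex.X 0 ⟶ X) (hf : P.complex.d 1 0 ≫ f = 0)
    have hK : ∀ g : K ⟶ X, g = 0 := fun g =>
      (Abelian.Ext.addEquiv₀ (X := K) (Y := X)).symm.injective (Subsingleton.elim _ _)
    have : Epi (ShortComplex.mk _ _ P.complex_d_comp_π_f_zero).g :=
      inferInstanceAs (Epi (P.π.f 0))
    have hg := P.exact₀.g_desc f hf
    have hf0 : f = 0 := hg.symm.trans ((congrArg (P.π.f 0 ≫ ·) (hK _)).trans comp_zero)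
    exact ⟨0, by rw [map_zero]; exact hf0.symm⟩
  | succ n =>
    rw [HomologicalComplex.exactAt_iff' _ n (n + 1) (n + 2) (by simp) (by simp),
      ShortComplex.moduleCat_exact_iff]
    intro (f : P.complex.X (n + 1) ⟶ X) (hf : P.complex.d (n + 2) (n + 1) ≫ f = 0)
    exact (P.extMk_eq_zero_iff f (n + 2) rfl hf n rfl).mp (Subsingleton.elim _ _)

/-- Local cohomology vanishes as soon as all the modules `Ext^i(R/𝔞^t, X)` do. -/
lemma isZero_localCohomology_of_subsingleton_ext (𝔞 : Ideal R) (X : ModuleCat.{u} R) (i : ℕ)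
    (h : ∀ t : ℕ, Subsingleton (Abelian.Ext (ModuleCat.of R (R ⧸ 𝔞 ^ t)) X i)) :
    IsZero ((localCohomology 𝔞 i).obj X) := by
  let D := localCohomology.diagram (localCohomology.idealPowersDiagram 𝔞) i
  have : HasColimit D := localCohomology.hasColimitDiagram _ i
  -- Evaluation at `X` preserves colimits, so the local cohomology of `X` is a colimit of the
  -- modules Ext^i(R/𝔞^t, X), all zero.
  have hc : IsColimit (((evaluation _ _).obj X).mapCocone (colimit.cocone D)) :=
    isColimitOfPreserves _ (colimit.isColimit D)
  refine (IsZero.iff_id_eq_zero _).mpr (hc.hom_ext fun j => ?_)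
  exact (isZero_ext_of_subsingleton _ X i (h (Opposite.unop (Opposite.unop j)))).eq_of_src _ _

end OldExt

/-! ### Grade expressed through Ext -/

section VanishBelow

open Abelian

variable {R : Type u} [CommRing R]

/-- `Ext^i(K, X) = 0` for all `i < n` and all finite modules `K` supported in `V(𝔞)`. -/
def ExtVanishesBelow (𝔞 : Ideal R) (n : ℕ) (X : Type u) [AddCommGroup X] [Module R X] : Prop :=
  ∀ K : ModuleCat.{u} R, Module.Finite R K →
    Module.support R K ⊆ PrimeSpectrum.zeroLocus (𝔞 : Set R) →
    ∀ i < n, Subsingleton (Ext K (ModuleCat.of R X) i)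

/-- A class is the sum of its composites with `g j ≫ h j`, each passing through Ext^i(K, Y) = 0.
This treats direct summands of finite powers of `Y` without forming the powers. -/
lemma subsingleton_ext_of_sum_comp_eq_id {K X Y : ModuleCat.{u} R} {ι : Type*} [Fintype ι]
    (g : ι → (X ⟶ Y)) (h : ι → (Y ⟶ X)) (hgh : ∑ j, g j ≫ h j = 𝟙 X) (i : ℕ)
    [Subsingleton (Ext K Y i)] : Subsingleton (Ext K X i) := by
  refine subsingleton_of_forall_eq 0 fun e => ?_
  rw [← e.comp_mk₀_id, ← hgh, Ext.mk₀_sum, Ext.comp_sum]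
  refine Finset.sum_eq_zero fun j _ => ?_
  rw [← Ext.mk₀_comp_mk₀, ← Ext.comp_assoc_of_third_deg_zero,
    Subsingleton.elim (e.comp (Ext.mk₀ (g j)) (add_zero i)) 0, Ext.zero_comp]

lemma subsingleton_ext_of_isZero {K X : ModuleCat.{u} R} (hX : IsZero X) (i : ℕ) :
    Subsingleton (Ext K X i) :=
  subsingleton_of_forall_eq 0 fun e => by
    rw [← e.comp_mk₀_id, hX.eq_of_src (𝟙 X) 0, Ext.mk₀_zero, Ext.comp_zero]

lemma ExtVanishesBelow.tensor_of_projective {𝔞 : Ideal R} {n : ℕ}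
    {N : Type u} [AddCommGroup N] [Module R N] (hN : ExtVanishesBelow 𝔞 n N)
    (M : Type u) [AddCommGroup M] [Module R M] [Module.Finite R M] [Module.Projective R M] :
    ExtVanishesBelow 𝔞 n (M ⊗[R] N) := by
  intro K hK hs i hi
  have := hN K hK hs i hi
  obtain ⟨m, π, σ, -, -, hσ⟩ := Module.Finite.exists_comp_eq_id_of_projective R M
  let g (j : Fin m) : ModuleCat.of R (M ⊗[R] N) ⟶ ModuleCat.of R N :=
    ModuleCat.ofHom ((TensorProduct.lid R N).toLinearMap ∘ₗ
      LinearMap.rTensor N (LinearMap.proj j ∘ₗ σ))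
  let h (j : Fin m) : ModuleCat.of R N ⟶ ModuleCat.of R (M ⊗[R] N) :=
    ModuleCat.ofHom (TensorProduct.mk R M N (π (Pi.single j 1)))
  refine subsingleton_ext_of_sum_comp_eq_id g h ?_ i
  refine ModuleCat.hom_ext (TensorProduct.ext' fun x y => ?_)
  simp only [ModuleCat.hom_sum, LinearMap.sum_apply]
  have hx : x = ∑ j, σ x j • π (Pi.single j 1) := by
    calc x = π (σ x) := (LinearMap.congr_fun hσ x).symm
      _ = π (∑ j, Pi.single j (σ x j)) := by rw [Finset.univ_sum_single]
      _ = _ := by simp [← map_smul, ← Pi.single_smul]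
  conv_rhs => rw [hx]
  simp [g, h, TensorProduct.sum_tmul, TensorProduct.smul_tmul]

end VanishBelow

/-! ### Local freeness and the support of Tor₁ -/

section LocallyFree

variable {R : Type u} [CommRing R]

/-- Off `V(𝔞)`, some multiple of the identity of `M` factors through a finite free module. -/
def IdFactorsOff (𝔞 : Ideal R) (M : Type u) [AddCommGroup M] [Module R M] : Prop :=
  ∀ p : PrimeSpectrum R, p ∉ PrimeSpectrum.zeroLocus (𝔞 : Set R) →
    ∃ s ∉ p.asIdeal, ∃ (n : ℕ) (α : M →ₗ[R] (Fin n → R)) (β : (Fin n → R) →ₗ[R] M),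
      β ∘ₗ α = s • LinearMap.id

/-- A surjection Rⁿ → M splits after localizing at `p`. Clearing denominators descends the
splitting: `s` makes the section integral, and `s'` turns an equality in the localization into one
in `M`. -/
lemma IsLocallyFreeOff.idFactorsOff [IsNoetherianRing R] {𝔞 : Ideal R} {M : Type u}
    [AddCommGroup M] [Module R M] [Module.Finite R M] (h : IsLocallyFreeOff 𝔞 M) :
    IdFactorsOff 𝔞 M := by
  intro p hp
  have hfree := Module.mem_freeLocus.mp (h p hp)
  obtain ⟨n, π, hπ⟩ := Module.Finite.exists_fin' R M
  let S := p.asIdeal.primeCompl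
  have : Module.FinitePresentation R M := Module.finitePresentation_of_finite R M
  obtain ⟨σ, hσ⟩ := Module.projective_lifting_property (LocalizedModule.map S π) LinearMap.id
    (LocalizedModule.map_surjective S π hπ)
  obtain ⟨α, s, hα⟩ := Module.FinitePresentation.exists_lift_of_isLocalizedModule S
    (LocalizedModule.mkLinearMap S (Fin n → R))
    (σ.restrictScalars R ∘ₗ LocalizedModule.mkLinearMap S M)
  obtain ⟨s', hs'⟩ := Module.Finite.exists_smul_of_comp_eq_of_isLocalizedModule S
    (LocalizedModule.mkLinearMap S M) (π ∘ₗ α) (s • LinearMap.id) (by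
      ext x
      have h1 := congr(LocalizedModule.map S π ($hα x))
      have h2 := LinearMap.congr_fun hσ (LocalizedModule.mkLinearMap S M x)
      simp only [LinearMap.comp_apply, LinearMap.smul_apply, LinearMap.id_apply,
        LinearMap.restrictScalars_apply, Submonoid.smul_def] at h1 h2 ⊢
      rw [LinearMap.map_smul_of_tower, h2] at h1
      rw [map_smul, ← h1]
      simp)
  refine ⟨s' * s, fun hm => (p.2.mem_or_mem hm).elim s'.2 s.2, n, α, (s' : R) • π, ?_⟩
  simpa [LinearMap.smul_comp, mul_smul, Submonoid.smul_def] using hs'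

lemma IdFactorsOff.exists_retraction {𝔞 : Ideal R} {M' M : Type u} [AddCommGroup M']
    [Module R M'] [AddCommGroup M] [Module R M] (h : IdFactorsOff 𝔞 M) {n : ℕ}
    {ι : M' →ₗ[R] (Fin n → R)} (hι : Function.Injective ι) {π : (Fin n → R) →ₗ[R] M}
    (hιπ : Function.Exact ι π) (hπ : Function.Surjective π) :
    ∀ p : PrimeSpectrum R, p ∉ PrimeSpectrum.zeroLocus (𝔞 : Set R) →
      ∃ s ∉ p.asIdeal, ∃ ρ : (Fin n → R) →ₗ[R] M', ρ ∘ₗ ι = s • LinearMap.id := by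
  intro p hp
  obtain ⟨s, hs, m, α, β, hβ⟩ := h p hp
  obtain ⟨τ, hτ⟩ := Module.projective_lifting_property π β hπ
  -- Since `τ` lifts `β`, the map s - ταπ is killed by `π` and so lands in the image of `ι`; as πι =
  -- 0, it is multiplication by `s` on that image.
  let θ : (Fin n → R) →ₗ[R] LinearMap.range ι :=
    LinearMap.codRestrict _ (s • LinearMap.id - τ ∘ₗ α ∘ₗ π) fun x => by
      have h1 := LinearMap.congr_fun hτ (α (π x))
      have h2 := LinearMap.congr_fun hβ (π x)
      simp only [LinearMap.comp_apply, LinearMap.smul_apply, LinearMap.id_apply] at h1 h2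
      exact (hιπ _).mp (by simp [h1, h2])
  let e := LinearEquiv.ofInjective ι hι
  refine ⟨s, hs, e.symm.toLinearMap ∘ₗ θ, LinearMap.ext fun x => e.injective (Subtype.ext ?_)⟩
  calc (e (e.symm (θ (ι x))) : Fin n → R) = s • ι x - τ (α (π (ι x))) := by
        rw [e.apply_symm_apply]; rfl
    _ = ι (s • x) := by simp [hιπ.apply_apply_eq_zero]

/-- If `M` or `N` is locally free off `V(𝔞)`, and `0 → M' → Rⁿ → M → 0` is exact, then the kernel
`Tor₁(M, N)` of `M' ⊗ N → Rⁿ ⊗ N` is supported in `V(𝔞)`. -/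
lemma support_ker_rTensor_subset {𝔞 : Ideal R} {M' M N : Type u} [AddCommGroup M']
    [Module R M'] [AddCommGroup M] [Module R M] [AddCommGroup N] [Module R N]
    (h : IdFactorsOff 𝔞 M ∨ IdFactorsOff 𝔞 N) {n : ℕ}
    {ι : M' →ₗ[R] (Fin n → R)} (hι : Function.Injective ι) {π : (Fin n → R) →ₗ[R] M}
    (hιπ : Function.Exact ι π) (hπ : Function.Surjective π) :
    Module.support R (LinearMap.ker (ι.rTensor N)) ⊆ PrimeSpectrum.zeroLocus (𝔞 : Set R) := by
  intro p hp
  by_contra hpa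
  obtain ⟨s, hs, hsz⟩ : ∃ s ∉ p.asIdeal, ∀ z, ι.rTensor N z = 0 → s • z = 0 := by
    rcases h with h | h
    · obtain ⟨s, hs, ρ, hρ⟩ := h.exists_retraction hι hιπ hπ p hpa
      refine ⟨s, hs, fun z hz => ?_⟩
      have := congr(LinearMap.rTensor N $hρ z)
      rw [LinearMap.rTensor_comp, LinearMap.comp_apply, hz, map_zero] at this
      simpa [LinearMap.rTensor_smul] using this.symm
    · obtain ⟨s, hs, m, α, β, hβ⟩ := h p hpa
      refine ⟨s, hs, fun z hz => ?_⟩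
      -- `z` lies in Tor₁(M, N), and `α` carries it into Tor₁(M, Rᵐ) = 0.
      have h1 : LinearMap.lTensor M' α z = 0 := by
        apply Module.Flat.rTensor_preserves_injective_linearMap (M := Fin m → R) ι hι
        rw [← LinearMap.comp_apply, LinearMap.rTensor_comp_lTensor,
          ← LinearMap.lTensor_comp_rTensor, LinearMap.comp_apply, hz, map_zero, map_zero]
      have := congr(LinearMap.lTensor M' $hβ z)
      rw [LinearMap.lTensor_comp, LinearMap.comp_apply, h1, map_zero] at this
      simpa [LinearMap.lTensor_smul] using this.symm
  refine hs (Module.annihilator_le_of_mem_support hp (Module.mem_annihilator.mpr fun z => ?_))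
  exact Subtype.ext (hsz z.1 z.2)

lemma IdFactorsOff.of_exact {𝔞 : Ideal R} {M' M : Type u} [AddCommGroup M']
    [Module R M'] [AddCommGroup M] [Module R M] (h : IdFactorsOff 𝔞 M) {n : ℕ}
    {ι : M' →ₗ[R] (Fin n → R)} (hι : Function.Injective ι) {π : (Fin n → R) →ₗ[R] M}
    (hιπ : Function.Exact ι π) (hπ : Function.Surjective π) : IdFactorsOff 𝔞 M' := fun p hp =>
  have ⟨s, hs, ρ, hρ⟩ := h.exists_retraction hι hιπ hπ p hp
  ⟨s, hs, n, ι, ρ, hρ⟩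

end LocallyFree

/-! ### Loss of grade under tensor products -/

section Tensor

open Abelian

variable {R : Type u} [CommRing R] [IsNoetherianRing R]

/-- The extra degree assumed for M' ⊗ N is used twice: degree 0 forces Tor₁(M, N) = 0 even when `k =
0`, and degree `i + 1` is the target of the connecting map from Ext^i(K, M ⊗ N). -/
lemma ExtVanishesBelow.tensor_of_exact {𝔞 : Ideal R} {n k : ℕ} {M' M N : Type u}
    [AddCommGroup M'] [Module R M'] [Module.Finite R M'] [AddCommGroup M] [Module R M]
    [AddCommGroup N] [Module R N] [Module.Finite R N]
    (hN : ExtVanishesBelow 𝔞 n N) (hkn : k ≤ n) (hM' : ExtVanishesBelow 𝔞 (k + 1) (M' ⊗[R] N))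
    (hfree : IdFactorsOff 𝔞 M ∨ IdFactorsOff 𝔞 N) {m : ℕ}
    {ι : M' →ₗ[R] (Fin m → R)} (hι : Function.Injective ι) {π : (Fin m → R) →ₗ[R] M}
    (hιπ : Function.Exact ι π) (hπ : Function.Surjective π) :
    ExtVanishesBelow 𝔞 k (M ⊗[R] N) := by
  let f := ι.rTensor N
  have hf : Function.Injective f := by
    have := hM' (ModuleCat.of R (LinearMap.ker f)) inferInstance
      (support_ker_rTensor_subset hfree hι hιπ hπ) 0 k.succ_pos
    have h0 : ModuleCat.ofHom (LinearMap.ker f).subtype = 0 :=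
      (Ext.addEquiv₀ (X := ModuleCat.of R (LinearMap.ker f))).symm.injective
        (Subsingleton.elim _ _)
    refine (injective_iff_map_eq_zero f).mpr fun z hz => ?_
    exact LinearMap.congr_fun (congrArg ModuleCat.Hom.hom h0) ⟨z, hz⟩
  let T : ShortComplex (ModuleCat.{u} R) :=
    ShortComplex.mk (ModuleCat.ofHom f) (ModuleCat.ofHom (π.rTensor N)) (by
      rw [← ModuleCat.ofHom_comp, ← LinearMap.rTensor_comp, hιπ.linearMap_comp_eq_zero,
        LinearMap.rTensor_zero]; rfl)
  have hT : T.ShortExact :=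
    { exact := (ShortComplex.ShortExact.moduleCat_exact_iff_function_exact _).mpr
        (rTensor_exact N hιπ hπ)
      mono_f := (ModuleCat.mono_iff_injective _).mpr hf
      epi_g := (ModuleCat.epi_iff_surjective _).mpr (LinearMap.rTensor_surjective N hπ) }
  intro K hK hs i hi
  refine subsingleton_of_forall_eq 0 fun e => ?_
  have h1 := hM' K hK hs (i + 1) (by omega)
  have h2 := hN.tensor_of_projective (Fin m → R) K hK hs i (by omega)
  obtain ⟨x, rfl⟩ := Ext.covariant_sequence_exact₃ K hT e rfl (h1.elim _ _)
  rw [h2.elim x 0, Ext.zero_comp]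

/-- If `N` has grade at least `n` in the sense of `Ext`, and `M` has projective dimension
`≤ p < n`, then `M ⊗ N` has grade at least `n - p`. -/
lemma ExtVanishesBelow.tensor {𝔞 : Ideal R} {n : ℕ} {N : Type u} [AddCommGroup N] [Module R N]
    [Module.Finite R N] (hN : ExtVanishesBelow 𝔞 n N) (p : ℕ) (hp : p < n)
    (M : Type u) [AddCommGroup M] [Module R M] [Module.Finite R M]
    (hM : HasProjectiveDimensionLE (ModuleCat.of R M) p)
    (hfree : IdFactorsOff 𝔞 M ∨ IdFactorsOff 𝔞 N) :
    ExtVanishesBelow 𝔞 (n - p) (M ⊗[R] N) := by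
  induction p generalizing M with
  | zero =>
    have : Projective (ModuleCat.of R M) := projective_iff_hasProjectiveDimensionLE_zero _ |>.mpr hM
    have : Module.Projective R M := (IsProjective.iff_projective M).mpr this
    exact hN.tensor_of_projective M
  | succ p ih =>
    obtain ⟨m, π, hπ⟩ := Module.Finite.exists_fin' R M
    have hS := LinearMap.shortExact_shortComplexKer hπ
    have hex := LinearMap.exact_subtype_ker_map π
    have hker := ih (by omega) (LinearMap.ker π)
      ((hS.hasProjectiveDimensionLT_X₃_iff p inferInstance).mp hM)
      (hfree.imp_left fun h => h.of_exact Subtype.val_injective hex hπ)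
    -- The bound `p + 1 < n` keeps the truncated subtraction honest.
    rw [show n - p = n - (p + 1) + 1 by omega] at hker
    exact hN.tensor_of_exact (by omega) hker hfree Subtype.val_injective hex hπ

end Tensor

/-! ### Depth and the Auslander–Buchsbaum formula -/

section AuslanderBuchsbaum

open Abelian IsLocalRing

variable {R : Type u} [CommRing R]

/-- Over a local ring, a finite module has a free cover whose kernel lies in `𝔪 Rⁿ`. -/
lemma exists_minimal_cover [IsLocalRing R]
    (M : Type u) [AddCommGroup M] [Module R M] [Module.Finite R M] :
    ∃ (n : ℕ) (π : (Fin n → R) →ₗ[R] M), Function.Surjective π ∧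
      ∀ z, π z = 0 → ∀ i, z i ∈ maximalIdeal R := by
  let b := Module.finBasis (ResidueField R) (ResidueField R ⊗[R] M)
  choose f hf using fun i =>
    TensorProduct.mk_surjective R M (ResidueField R) Ideal.Quotient.mk_surjective (b i)
  refine ⟨_, Fintype.linearCombination R f, ?_, fun z hz i => ?_⟩
  · rw [← LinearMap.range_eq_top, Fintype.range_linearCombination]
    exact span_eq_top_of_tmul_eq_basis f b hf
  · have h1 : ∑ j, residue R (z j) • b j = 0 := by
      have := congrArg (TensorProduct.mk R (ResidueField R) M 1) hz
      rw [Fintype.linearCombination_apply, map_sum, map_zero] at this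
      rw [← this]
      refine Finset.sum_congr rfl fun j _ => ?_
      rw [map_smul, hf]
      exact (algebraMap_smul (ResidueField R) (z j) (b j))
    have := Fintype.linearIndependent_iff.mp b.linearIndependent _ h1 i
    exact (residue_eq_zero_iff _).mp this

/-- With `x` generating `I`, the submodule I·Rⁿ is the image of (Rⁿ)^l under the map with
coefficients `x`; projectivity of `P` lifts `ι` along it. -/
lemma exists_eq_sum_smul_of_forall_mem [IsNoetherianRing R]
    {P : Type u} [AddCommGroup P] [Module R P]
    [Module.Projective R P] {n : ℕ} (I : Ideal R) (ι : P →ₗ[R] (Fin n → R))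
    (h : ∀ z i, ι z i ∈ I) :
    ∃ (l : ℕ) (x : Fin l → R) (ψ : Fin l → P →ₗ[R] (Fin n → R)),
      (∀ j, x j ∈ I) ∧ ι = ∑ j, x j • ψ j := by
  obtain ⟨l, x, hx⟩ := Submodule.fg_iff_exists_fin_generating_family.mp (IsNoetherian.noetherian I)
  let Φ : (Fin l → Fin n → R) →ₗ[R] (Fin n → R) := ∑ j, x j • LinearMap.proj j
  have hΦ : ∀ z, ι z ∈ LinearMap.range Φ := by
    intro z
    have hz : ∀ i, ∃ c : Fin l → R, ∑ j, c j • x j = ι z i := fun i =>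
      (Submodule.mem_span_range_iff_exists_fun R).mp (hx ▸ h z i)
    choose c hc using hz
    refine ⟨fun j i => c i j, funext fun i => ?_⟩
    rw [← hc]
    simp [Φ, mul_comm]
  obtain ⟨Ψ, hΨ⟩ := Module.projective_lifting_property Φ.rangeRestrict
    (ι.codRestrict _ hΦ) Φ.surjective_rangeRestrict
  refine ⟨l, x, fun j => LinearMap.proj j ∘ₗ Ψ,
    fun j => hx ▸ Submodule.subset_span ⟨j, rfl⟩, LinearMap.ext fun z => ?_⟩
  have := congrArg Subtype.val (LinearMap.congr_fun hΨ z)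
  calc ι z = Φ (Ψ z) := this.symm
    _ = _ := by simp [Φ]

variable (R) in
/-- The residue field as an object of the category of modules. -/
abbrev residueModule [IsLocalRing R] : ModuleCat.{u} R := ModuleCat.of R (R ⧸ maximalIdeal R)

/-- The maximal ideal annihilates Ext(k, -), and `ι` is a combination of maps with coefficients in
that ideal. -/
lemma comp_mk₀_eq_zero_of_forall_mem_maximalIdeal [IsLocalRing R] [IsNoetherianRing R]
    {P : Type u} [AddCommGroup P] [Module R P]
    [Module.Projective R P] {n : ℕ} (ι : P →ₗ[R] (Fin n → R))
    (h : ∀ z i, ι z i ∈ maximalIdeal R) {j : ℕ} (e : Ext (residueModule R) (ModuleCat.of R P) j) :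
    e.comp (Ext.mk₀ (ModuleCat.ofHom ι)) (add_zero j) = 0 := by
  obtain ⟨l, x, ψ, hx, rfl⟩ := exists_eq_sum_smul_of_forall_mem _ ι h
  have hsum : ModuleCat.ofHom (∑ j, x j • ψ j) = ∑ j, x j • ModuleCat.ofHom (ψ j) := by
    ext; simp
  rw [hsum, Ext.mk₀_sum, Ext.comp_sum]
  refine Finset.sum_eq_zero fun a _ => ?_
  rw [Ext.mk₀_smul, Ext.comp_smul]
  have hmem : x a ∈ Module.annihilator R (residueModule R) := by
    rw [Ideal.annihilator_quotient]; exact hx a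
  have := congr($(Ext.postcomp_smul_id_eq_zero_of_mem_annihilator (M := ModuleCat.of R (Fin n → R))
    hmem j).hom (e.comp (Ext.mk₀ (ModuleCat.ofHom (ψ a))) (add_zero j)))
  simpa [Ext.mk₀_smul] using this

lemma subsingleton_ext_pi {K : ModuleCat.{u} R} {j : ℕ}
    [Subsingleton (Ext K (ModuleCat.of R R) j)] (n : ℕ) :
    Subsingleton (Ext K (ModuleCat.of R (Fin n → R)) j) := by
  refine subsingleton_ext_of_sum_comp_eq_id (Y := ModuleCat.of R R)
    (fun i : Fin n => ModuleCat.ofHom (LinearMap.proj i))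
    (fun i => ModuleCat.ofHom (LinearMap.single R (fun _ => R) i)) ?_ j
  refine ModuleCat.hom_ext (LinearMap.ext fun v => ?_)
  simpa [ModuleCat.hom_sum] using Finset.univ_sum_single v

lemma support_residueModule [IsLocalRing R] : Module.support R (residueModule R) =
    PrimeSpectrum.zeroLocus (maximalIdeal R : Set R) := by
  rw [Module.support_eq_zeroLocus, Ideal.annihilator_quotient]

/-- The depth of a Noetherian local ring, in terms of `Ext`, is at most its dimension. -/
lemma exists_ext_self_nontrivial [IsLocalRing R] [IsNoetherianRing R]
    {d : ℕ} (hd : ringKrullDim R = d) :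
    ∃ t ≤ d, Nontrivial (Ext (residueModule R) (ModuleCat.of R R) t) ∧
      ∀ i < t, Subsingleton (Ext (residueModule R) (ModuleCat.of R R) i) := by
  classical
  have hex : ∃ t, t ≤ d ∧ Nontrivial (Ext (residueModule R) (ModuleCat.of R R) t) := by
    by_contra! hcon
    -- Vanishing in all degrees ≤ d would give a regular sequence of length d + 1, lowering the
    -- dimension of `R` by more than d.
    obtain ⟨rs, hlen, -, hreg⟩ := ModuleCat.exists_isRegular_of_exists_subsingleton_ext
      (maximalIdeal R) (d + 1) (ModuleCat.of R R)
      (by simpa using lt_top_iff_ne_top.mpr (maximalIdeal.isMaximal R).ne_top) (residueModule R)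
      support_residueModule (fun i hi => hcon i (by omega))
    have h1 := Module.supportDim_add_length_eq_supportDim_of_isRegular (M := R) rs hreg
    rw [Module.supportDim_self_eq_ringKrullDim, hd, hlen] at h1
    have : Nontrivial (R ⧸ (Ideal.ofList rs • ⊤ : Submodule R R)) := by
      have := hreg.top_ne_smul
      exact Submodule.Quotient.nontrivial_iff.mpr this.symm
    have h0 := Module.supportDim_ne_bot_of_nontrivial R (R ⧸ (Ideal.ofList rs • ⊤ : Submodule R R))
    generalize Module.supportDim R (R ⧸ (Ideal.ofList rs • ⊤ : Submodule R R)) = x at h0 h1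
    lift x to ℕ∞ using h0
    have h2 : x + ((d + 1 : ℕ) : ℕ∞) = d := by exact_mod_cast h1
    have h3 : ((d + 1 : ℕ) : ℕ∞) ≤ d := h2 ▸ le_add_self
    exact absurd (Nat.cast_le.mp h3) (by omega)
  exact ⟨Nat.find hex, (Nat.find_spec hex).1, (Nat.find_spec hex).2, fun i hi => by
    by_contra! hcon
    exact Nat.find_min hex hi ⟨hi.le.trans (Nat.find_spec hex).1, hcon⟩⟩

/-- The Auslander–Buchsbaum formula: if `t` is the depth of `R` and `M` has projective dimension
`p`, then `Ext^{t-p}(k, M) ≠ 0`. -/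
lemma exists_nontrivial_ext_of_projectiveDimension [IsLocalRing R] [IsNoetherianRing R]
    {t : ℕ}
    (ht : Nontrivial (Ext (residueModule R) (ModuleCat.of R R) t))
    (ht' : ∀ i < t, Subsingleton (Ext (residueModule R) (ModuleCat.of R R) i))
    (p : ℕ) (M : Type u) [AddCommGroup M] [Module R M] [Module.Finite R M]
    (hM : HasProjectiveDimensionLT (ModuleCat.of R M) (p + 1))
    (hM' : ¬ HasProjectiveDimensionLT (ModuleCat.of R M) p) :
    ∃ j, j + p = t ∧ Nontrivial (Ext (residueModule R) (ModuleCat.of R M) j) := by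
  induction p generalizing M with
  | zero =>
    refine ⟨t, rfl, ?_⟩
    have : Projective (ModuleCat.of R M) := projective_iff_hasProjectiveDimensionLE_zero _ |>.mpr hM
    have : Module.Projective R M := (IsProjective.iff_projective M).mpr this
    have : Module.Free R M := Module.free_of_flat_of_isLocalRing
    have : Nontrivial M := by
      by_contra! h
      exact hM' ((ModuleCat.isZero_of_subsingleton _).hasProjectiveDimensionLT_zero)
    let b := Module.Free.chooseBasis R M
    obtain ⟨i⟩ := b.index_nonempty
    by_contra! hcon
    refine not_subsingleton _ (subsingleton_ext_of_sum_comp_eq_id (ι := Unit)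
      (K := residueModule R) (X := ModuleCat.of R R) (Y := ModuleCat.of R M)
      (fun _ => ModuleCat.ofHom (LinearMap.toSpanSingleton R M (b i)))
      (fun _ => ModuleCat.ofHom (b.coord i)) ?_ t)
    ext
    simp
  | succ p ih =>
    obtain ⟨n, π, hπ, hmin⟩ := exists_minimal_cover (R := R) M
    have hS := LinearMap.shortExact_shortComplexKer hπ
    have hker := (hS.hasProjectiveDimensionLT_X₃_iff p inferInstance).mp hM
    obtain ⟨j, hj, hne⟩ := ih (LinearMap.ker π) hker fun h =>
      hM' (hS.hasProjectiveDimensionLT_X₃ p h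
        (hasProjectiveDimensionLT_of_ge _ 1 _ (by omega)))
    obtain ⟨e, he⟩ := exists_ne (0 : Ext (residueModule R) (ModuleCat.of R (LinearMap.ker π)) j)
    -- If the kernel is projective, then `j = t` and minimality of the cover is needed; otherwise `j
    -- < t` and Ext^j(k, Rⁿ) already vanishes. So `e` comes from Ext^{j-1}(k, M), and `j = 0` is
    -- excluded by left exactness.
    have he0 : e.comp (Ext.mk₀ (ModuleCat.ofHom (LinearMap.ker π).subtype)) (add_zero j) = 0 := by
      rcases p with _ | p
      · have : Projective (ModuleCat.of R (LinearMap.ker π)) :=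
          projective_iff_hasProjectiveDimensionLE_zero _ |>.mpr hker
        have : Module.Projective R (LinearMap.ker π) := (IsProjective.iff_projective _).mpr this
        exact comp_mk₀_eq_zero_of_forall_mem_maximalIdeal (LinearMap.ker π).subtype
          (fun z i => hmin z.1 z.2 i) e
      · have := ht' j (by omega)
        exact (subsingleton_ext_pi n).elim _ _
    rcases j with _ | j
    · have := hS.mono_f
      exact absurd (Ext.postcomp_mk₀_injective_of_mono _ π.shortComplexKer.f
        (he0.trans (map_zero _).symm)) he
    · obtain ⟨x, hx⟩ := Ext.covariant_sequence_exact₁ _ hS e he0 rfl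
      refine ⟨j, by omega, ⟨x, 0, ?_⟩⟩
      rintro rfl
      exact he (by rw [← hx, Ext.zero_comp])

end AuslanderBuchsbaum

/-! ### The theorem -/

section Main

open Abelian IsLocalRing

lemma support_quotient_pow_subset {R : Type u} [CommRing R] (𝔞 : Ideal R) (t : ℕ) :
    Module.support R (R ⧸ 𝔞 ^ t) ⊆ PrimeSpectrum.zeroLocus (𝔞 : Set R) := by
  rw [Module.support_eq_zeroLocus, Ideal.annihilator_quotient]
  exact fun p hp => p.2.le_of_pow_le hp

theorem mainTheorem1 {R : Type u} [CommRing R] [IsLocalRing R] [IsNoetherianRing R]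
    (𝔞 : Ideal R)
    (M : Type u) [AddCommGroup M] [Module R M] [Module.Finite R M]
    (N : Type u) [AddCommGroup N] [Module R N] [Module.Finite R N]
    (hpd : projectiveDimension (ModuleCat.of R M) < ⊤)
    (hfree : IsLocallyFreeOff 𝔞 M ∨ IsLocallyFreeOff 𝔞 N)
    (d : ℕ) (hd : ringKrullDim R = d)
    (r : ℕ) (hr : r < d)
    (hgrade : (d : ℕ∞) + r + 1 ≤ moduleGrade 𝔞 M + moduleGrade 𝔞 N) :
    ∀ i ≤ r, IsZero ((localCohomology 𝔞 i).obj (ModuleCat.of R (M ⊗[R] N))) := by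
  intro i hi
  refine isZero_localCohomology_of_subsingleton_ext 𝔞 _ i fun t => ?_
  -- If `M = 0`, `N = 0` or `𝔞 = ⊤`, some grade is infinite by convention and the hypothesis says
  -- nothing, so these cases are settled directly. Otherwise Nakayama rules out 𝔞L = L.
  rcases subsingleton_or_nontrivial M with hM | hM
  · exact subsingleton_ext_of_isZero (ModuleCat.isZero_of_subsingleton _) i
  rcases subsingleton_or_nontrivial N with hN | hN
  · exact subsingleton_ext_of_isZero (ModuleCat.isZero_of_subsingleton _) i
  rcases eq_or_ne 𝔞 ⊤ with rfl | h𝔞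
  · have : Subsingleton (R ⧸ (⊤ : Ideal R) ^ t) := by
      rw [Ideal.Quotient.subsingleton_iff, Ideal.top_pow]
    have := (ModuleCat.isZero_of_subsingleton
      (ModuleCat.of R (R ⧸ (⊤ : Ideal R) ^ t))).hasProjectiveDimensionLT_zero
    exact HasProjectiveDimensionLT.subsingleton _ 0 i (Nat.zero_le _) _
  have hsmul (I : Ideal R) (hI : I ≠ ⊤) (L : Type u) [AddCommGroup L] [Module R L]
      [Module.Finite R L] [Nontrivial L] : I • (⊤ : Submodule R L) ≠ ⊤ := fun h =>
    top_ne_bot (Submodule.eq_bot_of_le_smul_of_le_jacobson_bot I ⊤ Module.Finite.fg_top h.ge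
      ((le_maximalIdeal hI).trans (maximalIdeal_le_jacobson _)))
  obtain ⟨q, hq⟩ := (projectiveDimension_ne_top_iff _).mp hpd.ne
  classical
  have hex : ∃ q, HasProjectiveDimensionLT (ModuleCat.of R M) q := ⟨_, hq⟩
  obtain ⟨p, hp, hp'⟩ : ∃ p, HasProjectiveDimensionLT (ModuleCat.of R M) (p + 1) ∧
      ¬ HasProjectiveDimensionLT (ModuleCat.of R M) p := by
    rcases h : Nat.find hex with _ | p
    · have h0 := h ▸ Nat.find_spec hex
      exact absurd ((ModuleCat.isZero_iff_subsingleton).mp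
        ((hasProjectiveDimensionLT_zero_iff_isZero _).mp h0)) (not_subsingleton M)
    · exact ⟨p, h ▸ Nat.find_spec hex, Nat.find_min hex (by omega)⟩
  obtain ⟨s, hsd, hs, hs'⟩ := exists_ext_self_nontrivial hd
  obtain ⟨j, hj, hne⟩ := exists_nontrivial_ext_of_projectiveDimension hs hs' p M hp hp'
  -- A longer regular sequence in `𝔞` lies in the maximal ideal and would force Ext^j(k, M) = 0.
  have hgM : moduleGrade 𝔞 M ≤ j := by
    rw [moduleGrade, if_neg (hsmul 𝔞 h𝔞 M)]
    refine iSup_le fun rs => iSup_le fun hrs => iSup_le fun hreg => ?_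
    by_contra! hlt
    have := ModuleCat.subsingleton_ext_of_exists_isRegular (maximalIdeal R) (residueModule R)
      support_residueModule.subset (ModuleCat.of R M)
      (lt_top_iff_ne_top.mpr (hsmul _ (maximalIdeal.isMaximal R).ne_top M)) rs
      (fun x hx => le_maximalIdeal h𝔞 (hrs x hx)) hreg j (by exact_mod_cast hlt)
    exact not_subsingleton _ this
  -- Here `j + p = s ≤ d`, and the finite `j` cancels. The strict form lets an actual sequence
  -- longer than `p + r` be extracted, even if the supremum is infinite.
  have hgN : ((p + r : ℕ) : ℕ∞) < moduleGrade 𝔞 N := by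
    have h1 : (d : ℕ∞) + r + 1 ≤ j + moduleGrade 𝔞 N := hgrade.trans (by gcongr)
    have h2 : (j : ℕ∞) + ((p + r + 1 : ℕ) : ℕ∞) ≤ d + r + 1 := by
      norm_cast; omega
    have h3 := (ENat.add_le_add_iff_left (ENat.natCast_ne_top j)).mp (h2.trans h1)
    exact lt_of_lt_of_le (by exact_mod_cast Nat.lt_succ_self _) h3
  rw [moduleGrade, if_neg (hsmul 𝔞 h𝔞 N)] at hgN
  simp only [lt_iSup_iff] at hgN
  obtain ⟨rs, hrs, hreg, hlt⟩ := hgN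
  have hlt' : p + r < rs.length := by exact_mod_cast hlt
  have hN : ExtVanishesBelow 𝔞 rs.length N := fun K hK hsK =>
    ModuleCat.subsingleton_ext_of_exists_isRegular 𝔞 K hsK (ModuleCat.of R N)
      (lt_top_iff_ne_top.mpr (hsmul 𝔞 h𝔞 N)) rs hrs hreg
  exact hN.tensor p (by omega) M hp
    (hfree.imp IsLocallyFreeOff.idFactorsOff IsLocallyFreeOff.idFactorsOff) _ inferInstance
    (support_quotient_pow_subset 𝔞 t) i (by omega)

end Main
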